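/- Let $A$ be a ring with unit, $\mathfrak C$ an $A$-coring, and $\Sigma$ a right $\mathfrak C$-comodule with coaction $u\mapsto u_{[0]}\otimes_A u_{[1]}$; write $\Sigma^*=\mathrm{Hom}_A(\Sigma,A)$ and let $T=\mathrm{End}^{\mathfrak C}(\Sigma)$ be the ring of right $\mathfrak C$-colinear endomorphisms of $\Sigma$. Rings other than $A$ need not have a unit. A ring $R$ is called firm if the multiplication map $R\otimes_R R\to R$ is bijective, and a left $R$-module $X$ is called firm if $R\otimes_R X\to X$, $r\otimes x\mapsto rx$, is bijective. An $R$-$\mathfrak C$-bicomodule is a right $\mathfrak C$-comodule $X$ with a left $R$-module structure given by a ring morphism $R\to\mathrm{End}^{\mathfrak C}(X)$. * An $R$-$\mathfrak C$-bicomodule $\Sigma$ is an $R$-$\mathfrak C$ Galois comodule if $\Sigma$ is a firm left $R$-module, its $R$-action is induced by some ring morphism $\iota:R\to\Sigma\otimes_A\Sigma^*$ (where $\Sigma\otimes_A\Sigma^*$ has the product $(u\otimes f)(v\otimes g)=uf(v)\otimes g$ and acts on $\Sigma$ by $(u\otimes f)x=uf(x)$), and the map $\mathsf{can}:\Sigma^*\otimes_R\Sigma\to\mathfrak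 C$, $f\otimes u\mapsto f(u_{[0]})u_{[1]}$, is an isomorphism. * An $R$-$\mathfrak C$-bicomodule $X$ is an $R$-$\mathfrak C$ comonadic-Galois comodule if $X$ is a firm left $R$-module and $\mathsf{can}_M:\mathrm{Hom}_A(X,M)\otimes_R X\to M\otimes_A\mathfrak C$, $f\otimes x\mapsto f(x_{[0]})\otimes x_{[1]}$, is an isomorphism for every right $A$-module $M$. **Proposition.** Let $R$ be a firm ring and let $\Sigma$ be an $R$-$\mathfrak C$ Galois comodule. Let $S$ be any firm ring with $R\subset S\subset T$ or, more generally, with ring morphisms $R\to S\to T$ whose composite is the given morphism $R\to T$. Equip $S\otimes_S\Sigma$ with the left $S$-action $t(s\otimes u)=ts\otimes u$, the right $A$-action $(s\otimes u)a=s\otimes ua$ and the coaction $s\otimes u\mapsto(s\otimes u_{[0]})\otimes_A u_{[1]}$. Then $S\otimes_S\Sigma$ is an $S$-$\mathfrak C$ comonadic-Galois comodule. -/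

import Mathlib

open scoped TensorProduct
open MulOpposite (op)

/-! ### Balanced tensor products

All rings below may be noncommutative, and the rings `R`, `S` may lack a unit. Right modules over a
unital ring `A` are `Aᵐᵒᵖ`-modules, so that `op a • m` stands for `m a`. -/

section BalTensor

variable {R N M P : Type*} [AddCommGroup N] [AddCommGroup M] [AddCommGroup P]

/-- The tensor product of abelian groups `N`, `M` balanced over `R`, where `α` is the right action
of `R` on `N` and `β` is the left action of `R` on `M`: the quotient of `N ⊗ M` (over `ℤ`) by the
relations `n r ⊗ m = n ⊗ r m`. -/
def BalTensor (α : R → N →+ N) (β : R → M →+ M) : Type _ :=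
  (N ⊗[ℤ] M) ⧸ AddSubgroup.closure
    {x : N ⊗[ℤ] M | ∃ (r : R) (n : N) (m : M), x = (α r n) ⊗ₜ[ℤ] m - n ⊗ₜ[ℤ] (β r m)}

namespace BalTensor

variable {α : R → N →+ N} {β : R → M →+ M}

instance : AddCommGroup (BalTensor α β) :=
  inferInstanceAs (AddCommGroup ((N ⊗[ℤ] M) ⧸ AddSubgroup.closure
    {x : N ⊗[ℤ] M | ∃ (r : R) (n : N) (m : M), x = (α r n) ⊗ₜ[ℤ] m - n ⊗ₜ[ℤ] (β r m)}))

variable (α β) in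
/-- The pure tensor `n ⊗ m`, as a biadditive map. -/
def tmul : N →+ M →+ BalTensor α β :=
  AddMonoidHom.mk' (fun n => AddMonoidHom.mk'
    (fun m => (QuotientAddGroup.mk (n ⊗ₜ[ℤ] m) : BalTensor α β))
    (fun m m' => by rw [TensorProduct.tmul_add]; rfl))
    (fun n n' => by ext m; exact congrArg _ (TensorProduct.add_tmul n n' m))

theorem tmul_balanced (r : R) (n : N) (m : M) :
    tmul α β (α r n) m = tmul α β n (β r m) := by
  refine (QuotientAddGroup.eq).2 ?_
  rw [← neg_mem_iff, neg_add_rev, neg_neg, neg_add_eq_sub]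
  have h : α r n ⊗ₜ[ℤ] m - n ⊗ₜ[ℤ] β r m ∈ AddSubgroup.closure
    {x : N ⊗[ℤ] M | ∃ (r : R) (n : N) (m : M), x = (α r n) ⊗ₜ[ℤ] m - n ⊗ₜ[ℤ] (β r m)} :=
    AddSubgroup.subset_closure ⟨r, n, m, rfl⟩
  rw [← neg_mem_iff, neg_sub] at h
  rw [← neg_mem_iff, neg_sub]
  exact h

/-- A biadditive balanced map factors through the balanced tensor product. -/
def lift (f : N →+ M →+ P) (hf : ∀ r n m, f (α r n) m = f n (β r m)) : BalTensor α β →+ P :=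
  QuotientAddGroup.lift _
    (TensorProduct.liftAddHom f (fun z n m => by simp))
    (by
      rw [AddSubgroup.closure_le]
      rintro _ ⟨r, n, m, rfl⟩
      simp [hf])

@[simp]
theorem lift_tmul (f : N →+ M →+ P) (hf : ∀ r n m, f (α r n) m = f n (β r m)) (n : N) (m : M) :
    lift f hf (tmul α β n m) = f n m := rfl

theorem induction {p : BalTensor α β → Prop} (x : BalTensor α β)
    (tmul : ∀ n m, p (tmul α β n m)) (add : ∀ x y, p x → p y → p (x + y)) : p x := by
  obtain ⟨t, rfl⟩ := QuotientAddGroup.mk_surjective x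
  induction t with
  | zero =>
    have h := tmul 0 0
    rw [map_zero] at h
    exact h
  | tmul n m => exact tmul n m
  | add a b ha hb => exact add _ _ ha hb

theorem hom_ext {f g : BalTensor α β →+ P} (h : ∀ n m, f (tmul α β n m) = g (tmul α β n m)) :
    f = g := by
  ext x
  induction x using induction with
  | tmul n m => exact h n m
  | add x y hx hy => rw [map_add, map_add, hx, hy]

/-- The map `n ⊗ m ↦ n ⊗ g m`, for `g` commuting with the action of `R`. -/
def mapRight (g : M →+ M) (hg : ∀ r m, β r (g m) = g (β r m)) : BalTensor α β →+ BalTensor α β :=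
  lift ((tmul α β).compl₂ g) (fun r n m => by
    change tmul α β (α r n) (g m) = tmul α β n (g (β r m))
    rw [tmul_balanced, hg])

/-- The map `n ⊗ m ↦ f n ⊗ m`, for `f` commuting with the action of `R`. -/
def mapLeft (f : N →+ N) (hf : ∀ r n, α r (f n) = f (α r n)) : BalTensor α β →+ BalTensor α β :=
  lift ((tmul α β).comp f) (fun r n m => by
    change tmul α β (f (α r n)) m = tmul α β (f n) (β r m)
    rw [← tmul_balanced, hf])

/-- The action of `B` on a balanced tensor product through its right-hand factor. -/
abbrev moduleOfRight {B : Type*} [Semiring B] [Module B M]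
    (h : ∀ r (b : B) (m : M), β r (b • m) = b • β r m) : Module B (BalTensor α β) where
  smul b x := mapRight (DistribSMul.toAddMonoidHom M b) (fun r m => h r b m) x
  one_smul x := by
    change mapRight _ _ x = x
    induction x using induction with
    | tmul n m => exact congrArg (tmul α β n) (one_smul B m)
    | add x y hx hy => rw [map_add, hx, hy]
  mul_smul b c x := by
    change mapRight _ _ x = mapRight _ _ (mapRight _ _ x)
    induction x using induction with
    | tmul n m => exact congrArg (tmul α β n) (mul_smul b c m)
    | add x y hx hy => rw [map_add, hx, hy, map_add, map_add]
  smul_zero b := map_zero (mapRight _ _)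
  smul_add b := map_add (mapRight _ _)
  add_smul b c x := by
    change mapRight _ _ x = mapRight _ _ x + mapRight _ _ x
    induction x using induction with
    | tmul n m => exact (congrArg (tmul α β n) (add_smul b c m)).trans (map_add _ _ _)
    | add x y hx hy => rw [map_add, hx, hy, map_add, map_add, add_add_add_comm]
  zero_smul x := by
    change mapRight _ _ x = 0
    induction x using induction with
    | tmul n m => exact (congrArg (tmul α β n) (zero_smul B m)).trans (map_zero _)
    | add x y hx hy => rw [map_add, hx, hy, add_zero]

/-- The action of `B` on a balanced tensor product through its left-hand factor. -/
abbrev moduleOfLeft {B : Type*} [Semiring B] [Module B N]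
    (h : ∀ r (b : B) (n : N), α r (b • n) = b • α r n) : Module B (BalTensor α β) where
  smul b x := mapLeft (DistribSMul.toAddMonoidHom N b) (fun r n => h r b n) x
  one_smul x := by
    change mapLeft _ _ x = x
    induction x using induction with
    | tmul n m => exact congrArg (tmul α β · m) (one_smul B n)
    | add x y hx hy => rw [map_add, hx, hy]
  mul_smul b c x := by
    change mapLeft _ _ x = mapLeft _ _ (mapLeft _ _ x)
    induction x using induction with
    | tmul n m => exact congrArg (tmul α β · m) (mul_smul b c n)
    | add x y hx hy => rw [map_add, hx, hy, map_add, map_add]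
  smul_zero b := map_zero (mapLeft _ _)
  smul_add b := map_add (mapLeft _ _)
  add_smul b c x := by
    change mapLeft _ _ x = mapLeft _ _ x + mapLeft _ _ x
    induction x using induction with
    | tmul n m =>
      exact (congrArg (tmul α β · m) (add_smul b c n)).trans
        (DFunLike.congr_fun (map_add (tmul α β) _ _) m)
    | add x y hx hy => rw [map_add, hx, hy, map_add, map_add, add_add_add_comm]
  zero_smul x := by
    change mapLeft _ _ x = 0
    induction x using induction with
    | tmul n m =>
      exact (congrArg (tmul α β · m) (zero_smul B n)).trans
        (DFunLike.congr_fun (map_zero (tmul α β)) m)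
    | add x y hx hy => rw [map_add, hx, hy, add_zero]

end BalTensor

end BalTensor

/-! ### Tensor products over a unital ring -/

section TensorOver

variable (A : Type*) [Ring A]

/-- The right action of `A` on a right `A`-module. -/
abbrev rightAct (N : Type*) [AddCommGroup N] [Module Aᵐᵒᵖ N] (a : A) : N →+ N :=
  DistribSMul.toAddMonoidHom N (op a)

/-- The left action of `A` on a left `A`-module. -/
abbrev leftAct (M : Type*) [AddCommGroup M] [Module A M] (a : A) : M →+ M :=
  DistribSMul.toAddMonoidHom M a

/-- `N ⊗_A M` for a right `A`-module `N` and a left `A`-module `M`. -/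
abbrev TensorOver (N M : Type*) [AddCommGroup N] [Module Aᵐᵒᵖ N] [AddCommGroup M] [Module A M] :
    Type _ :=
  BalTensor (rightAct A N) (leftAct A M)

variable {A} {N N' N'' M M' D : Type*} [AddCommGroup N] [Module Aᵐᵒᵖ N]
  [AddCommGroup N'] [Module Aᵐᵒᵖ N'] [AddCommGroup N''] [Module Aᵐᵒᵖ N'']
  [AddCommGroup M] [Module A M] [AddCommGroup M'] [Module A M'] [AddCommGroup D] [Module A D]

/-- `(n ⊗ m) a = n ⊗ (m a)` when `M` is an `A`-bimodule. -/
instance [Module Aᵐᵒᵖ M] [SMulCommClass A Aᵐᵒᵖ M] :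
    Module Aᵐᵒᵖ (BalTensor (rightAct A N) (leftAct A M)) :=
  BalTensor.moduleOfRight (fun a b m => smul_comm a b m)

/-- `a (n ⊗ m) = (a n) ⊗ m` when `N` is an `A`-bimodule. -/
instance [Module A N] [SMulCommClass A Aᵐᵒᵖ N] :
    Module A (BalTensor (rightAct A N) (leftAct A M)) :=
  BalTensor.moduleOfLeft (fun a b n => (smul_comm b (op a) n).symm)

namespace TensorOver

variable (A) in
/-- The pure tensor `n ⊗_A m`. -/
abbrev mk : N →+ M →+ TensorOver A N M := BalTensor.tmul (rightAct A N) (leftAct A M)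

variable (M) in
/-- The map `f ⊗_A M`. -/
def rT (f : N →ₗ[Aᵐᵒᵖ] N') : TensorOver A N M →+ TensorOver A N' M :=
  BalTensor.lift ((mk A).comp f.toAddMonoidHom) (fun a n m => by
    change mk A (f (op a • n)) m = mk A (f n) (a • m)
    rw [map_smul f]
    exact BalTensor.tmul_balanced (α := rightAct A N') (β := leftAct A M) a (f n) m)

variable (N) in
/-- The map `N ⊗_A g`. -/
def lT (g : M →ₗ[A] M') : TensorOver A N M →+ TensorOver A N M' :=
  BalTensor.lift ((mk A).compl₂ g.toAddMonoidHom) (fun a n m => by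
    change mk A (op a • n) (g m) = mk A n (g (a • m))
    rw [map_smul g]
    exact BalTensor.tmul_balanced (α := rightAct A N) (β := leftAct A M') a n (g m))

@[simp]
theorem rT_mk (f : N →ₗ[Aᵐᵒᵖ] N') (n : N) (m : M) : rT M f (mk A n m) = mk A (f n) m := rfl

@[simp]
theorem lT_mk (g : M →ₗ[A] M') (n : N) (m : M) : lT N g (mk A n m) = mk A n (g m) := rfl

theorem smul_mk [Module A N] [SMulCommClass A Aᵐᵒᵖ N] (a : A) (n : N) (m : M) :
    a • mk A n m = mk A (a • n) m := rfl

theorem op_smul_mk [Module Aᵐᵒᵖ M] [SMulCommClass A Aᵐᵒᵖ M] (a : Aᵐᵒᵖ) (n : N) (m : M) :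
    a • mk A n m = mk A n (a • m) := rfl

/-- The canonical map `A ⊗_A M → M`, `a ⊗ m ↦ a m`. -/
def lUnit : TensorOver A A M →+ M :=
  BalTensor.lift (smulAddHom A M) (fun a b m => by
    change (b * a) • m = b • a • m
    rw [mul_smul])

/-- The canonical map `N ⊗_A A → N`, `n ⊗ a ↦ n a`. -/
def rUnit : TensorOver A N A →+ N :=
  BalTensor.lift
    (AddMonoidHom.mk' (fun n => AddMonoidHom.mk' (fun a : A => op a • n)
      (fun a b => by rw [MulOpposite.op_add, add_smul]))
      (fun n n' => by ext a; exact smul_add (op a) n n'))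
    (fun a n b => by
      change op b • op a • n = op (a * b) • n
      rw [MulOpposite.op_mul, mul_smul])

/-- The map `m ⊗ d ↦ (n ⊗ m) ⊗ d ↦ n ⊗ (m ⊗ d)`, curried. -/
def assocAux [Module Aᵐᵒᵖ M] [SMulCommClass A Aᵐᵒᵖ M] :
    TensorOver A N M →+ D →+ TensorOver A N (TensorOver A M D) :=
  BalTensor.lift (P := D →+ TensorOver A N (TensorOver A M D))
    (AddMonoidHom.mk' (fun n => AddMonoidHom.mk' (fun m => (mk A n).comp (mk A m))
        (fun m m' => by
          ext d
          change mk A n (mk A (m + m') d) = mk A n (mk A m d) + mk A n (mk A m' d)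
          rw [map_add (mk A), AddMonoidHom.add_apply, map_add]))
      (fun n n' => by
        ext m d
        change mk A (n + n') (mk A m d) = mk A n (mk A m d) + mk A n' (mk A m d)
        rw [map_add (mk A), AddMonoidHom.add_apply]))
    (fun a n m => by
      ext d
      exact BalTensor.tmul_balanced (α := rightAct A N) (β := leftAct A (TensorOver A M D))
        a n (mk A m d))

/-- The associativity map `(N ⊗_A M) ⊗_A D → N ⊗_A (M ⊗_A D)`. -/
def assoc [Module Aᵐᵒᵖ M] [SMulCommClass A Aᵐᵒᵖ M] :
    TensorOver A (TensorOver A N M) D →+ TensorOver A N (TensorOver A M D) :=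
  BalTensor.lift assocAux
    (fun a x d => by
      induction x using BalTensor.induction with
      | tmul n m =>
        exact congrArg (mk A n)
          (BalTensor.tmul_balanced (α := rightAct A M) (β := leftAct A D) a m d)
      | add x y hx hy =>
        rw [map_add, map_add, map_add, AddMonoidHom.add_apply, AddMonoidHom.add_apply, hx, hy])

@[simp]
theorem assoc_mk [Module Aᵐᵒᵖ M] [SMulCommClass A Aᵐᵒᵖ M] (n : N) (m : M) (d : D) :
    assoc (mk A (mk A n m) d) = mk A n (mk A m d) := rfl

theorem rT_id (x : TensorOver A N M) : rT M (LinearMap.id : N →ₗ[Aᵐᵒᵖ] N) x = x := by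
  refine DFunLike.congr_fun (g := AddMonoidHom.id _) (BalTensor.hom_ext fun n m => ?_) x
  rfl

theorem rT_comp (g : N' →ₗ[Aᵐᵒᵖ] N'') (f : N →ₗ[Aᵐᵒᵖ] N') (x : TensorOver A N M) :
    rT M (g ∘ₗ f) x = rT M g (rT M f x) := by
  refine DFunLike.congr_fun (g := (rT M g).comp (rT M f)) (BalTensor.hom_ext fun n m => ?_) x
  rfl

theorem rT_add (f g : N →ₗ[Aᵐᵒᵖ] N') (x : TensorOver A N M) :
    rT M (f + g) x = rT M f x + rT M g x := by
  refine DFunLike.congr_fun (g := rT M f + rT M g) (BalTensor.hom_ext fun n m => ?_) x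
  change mk A (f n + g n) m = mk A (f n) m + mk A (g n) m
  rw [map_add, AddMonoidHom.add_apply]

theorem rT_op_smul [Module Aᵐᵒᵖ M] [SMulCommClass A Aᵐᵒᵖ M] (f : N →ₗ[Aᵐᵒᵖ] N')
    (a : Aᵐᵒᵖ) (x : TensorOver A N M) : rT M f (a • x) = a • rT M f x := by
  induction x using BalTensor.induction with
  | tmul n m => rfl
  | add x y hx hy => rw [smul_add, map_add, hx, hy, map_add, smul_add]

end TensorOver

end TensorOver

/-! ### Corings and comodules -/

/-- A homomorphism of `A`-bimodules. -/
structure BimodHom (A C D : Type*) [Ring A] [AddCommGroup C] [Module A C] [Module Aᵐᵒᵖ C]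
    [AddCommGroup D] [Module A D] [Module Aᵐᵒᵖ D] where
  /-- The map, as a homomorphism of left `A`-modules. -/
  left : C →ₗ[A] D
  map_op_smul : ∀ (a : Aᵐᵒᵖ) (c : C), left (a • c) = a • left c

/-- The underlying homomorphism of right `A`-modules. -/
def BimodHom.right {A C D : Type*} [Ring A] [AddCommGroup C] [Module A C] [Module Aᵐᵒᵖ C]
    [AddCommGroup D] [Module A D] [Module Aᵐᵒᵖ D] (f : BimodHom A C D) : C →ₗ[Aᵐᵒᵖ] D where
  toFun := f.left
  map_add' := map_add f.left
  map_smul' := f.map_op_smul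

/-- An `A`-coring structure on the `A`-bimodule `C`. -/
class Coring (A C : Type*) [Ring A] [AddCommGroup C] [Module A C] [Module Aᵐᵒᵖ C]
    [SMulCommClass A Aᵐᵒᵖ C] where
  /-- The comultiplication. -/
  comul : BimodHom A C (TensorOver A C C)
  /-- The counit. -/
  counit : BimodHom A C A
  coassoc : ∀ c : C, TensorOver.assoc (TensorOver.rT C comul.right (comul.left c)) =
    TensorOver.lT C comul.left (comul.left c)
  counit_left : ∀ c : C, TensorOver.lUnit (TensorOver.rT C counit.right (comul.left c)) = c
  counit_right : ∀ c : C, TensorOver.rUnit (TensorOver.lT C counit.left (comul.left c)) = c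

/-- A right `C`-comodule structure on the right `A`-module `M`. -/
class RightComodule (A C M : Type*) [Ring A] [AddCommGroup C] [Module A C] [Module Aᵐᵒᵖ C]
    [SMulCommClass A Aᵐᵒᵖ C] [Coring A C] [AddCommGroup M] [Module Aᵐᵒᵖ M] where
  /-- The coaction `m ↦ m₀ ⊗ m₁`. -/
  coact : M →ₗ[Aᵐᵒᵖ] TensorOver A M C
  coassoc : ∀ m : M, TensorOver.assoc (TensorOver.rT C coact (coact m)) =
    TensorOver.lT M (Coring.comul (A := A) (C := C)).left (coact m)
  counit : ∀ m : M,
    TensorOver.rUnit (TensorOver.lT M (Coring.counit (A := A) (C := C)).left (coact m)) = m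

section Comodule

variable (A C : Type*) [Ring A] [AddCommGroup C] [Module A C] [Module Aᵐᵒᵖ C]
  [SMulCommClass A Aᵐᵒᵖ C] [Coring A C]

/-- The coaction of a right comodule. -/
abbrev coact (M : Type*) [AddCommGroup M] [Module Aᵐᵒᵖ M] [RightComodule A C M] :
    M →ₗ[Aᵐᵒᵖ] TensorOver A M C :=
  RightComodule.coact

variable (X : Type*) [AddCommGroup X] [Module Aᵐᵒᵖ X] [RightComodule A C X]

/-- The ring `End^C(X)` of right `C`-colinear endomorphisms of the comodule `X`, with composition
as multiplication. -/
def ComodEnd : Subring (Module.End Aᵐᵒᵖ X) where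
  carrier := {f | ∀ x : X, coact A C X (f x) = TensorOver.rT C f (coact A C X x)}
  mul_mem' {f g} hf hg x := by
    change coact A C X (f (g x)) = TensorOver.rT C (f ∘ₗ g) (coact A C X x)
    rw [hf, hg, TensorOver.rT_comp]
  one_mem' x := (TensorOver.rT_id _).symm
  add_mem' {f g} hf hg x := by
    rw [LinearMap.add_apply, map_add, hf, hg, TensorOver.rT_add]
  zero_mem' x := by
    have h := TensorOver.rT_add (M := C) (0 : Module.End Aᵐᵒᵖ X) 0 (coact A C X x)
    rw [add_zero, left_eq_add] at h
    rw [h, LinearMap.zero_apply, map_zero]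
  neg_mem' {f} hf x := by
    have h := TensorOver.rT_add (M := C) (-f) f (coact A C X x)
    have h0 := TensorOver.rT_add (M := C) (0 : Module.End Aᵐᵒᵖ X) 0 (coact A C X x)
    rw [add_zero, left_eq_add] at h0
    rw [neg_add_cancel, h0, ← hf] at h
    rw [LinearMap.neg_apply, map_neg]
    exact (eq_neg_of_add_eq_zero_left h.symm).symm

end Comodule

/-! ### Firm rings and firm modules -/

/-- The multiplication map `R ⊗_R R → R`. -/
def ringMulMap (R : Type*) [NonUnitalRing R] :
    BalTensor (fun r : R => AddMonoidHom.mulRight r) (fun r : R => AddMonoidHom.mulLeft r) →+ R :=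
  BalTensor.lift AddMonoidHom.mul (fun r x y => mul_assoc x r y)

/-- A (not necessarily unital) ring `R` is firm if multiplication `R ⊗_R R → R` is bijective. -/
def IsFirmRing (R : Type*) [NonUnitalRing R] : Prop := Function.Bijective (ringMulMap R)

section Bicomodule

/- An object of the category of `R`-`C`-bicomodules is a right `C`-comodule `X` with a left
`R`-module structure that commutes with the right `A`-action and for which the coaction is left
`R`-linear; this is the same as a ring homomorphism `j : R → End^C(X)`, and `r x = j r x`. -/

variable {A C X R : Type*} [Ring A] [AddCommGroup C] [Module A C] [Module Aᵐᵒᵖ C]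
  [SMulCommClass A Aᵐᵒᵖ C] [Coring A C] [AddCommGroup X] [Module Aᵐᵒᵖ X] [RightComodule A C X]
  [NonUnitalRing R]

/-- The left `R`-action on `X` given by `j`. -/
def endAct (j : R →ₙ+* ComodEnd A C X) (r : R) : X →+ X := (j r : Module.End Aᵐᵒᵖ X).toAddMonoidHom

/-- `R ⊗_R X`, for the left `R`-action on `X` given by `j`. -/
abbrev FirmPart (j : R →ₙ+* ComodEnd A C X) : Type _ :=
  BalTensor (fun r : R => AddMonoidHom.mulRight r) (endAct j)

/-- The multiplication map `R ⊗_R X → X`, `r ⊗ x ↦ r x`. -/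
def actMap (j : R →ₙ+* ComodEnd A C X) : FirmPart j →+ X :=
  BalTensor.lift (AddMonoidHom.mk' (endAct j) (fun r s => by
      ext x
      change (j (r + s) : Module.End Aᵐᵒᵖ X) x = _
      rw [map_add]
      rfl))
    (fun r s x => by
      change (j (s * r) : Module.End Aᵐᵒᵖ X) x = _
      rw [map_mul]
      rfl)

/-- `X` is firm as a left `R`-module: multiplication `R ⊗_R X → X` is bijective. -/
def IsFirmModule (j : R →ₙ+* ComodEnd A C X) : Prop := Function.Bijective (actMap j)

namespace FirmPart

/-- `(r ⊗ x) a = r ⊗ (x a)`. -/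
instance (j : R →ₙ+* ComodEnd A C X) :
    Module Aᵐᵒᵖ (BalTensor (fun r : R => AddMonoidHom.mulRight r) (endAct j)) :=
  BalTensor.moduleOfRight (fun r a x => map_smul (j r : Module.End Aᵐᵒᵖ X) a x)

/-- The right `A`-linear map `X → R ⊗_R X`, `x ↦ r ⊗ x`. -/
def incl (j : R →ₙ+* ComodEnd A C X) (r : R) : X →ₗ[Aᵐᵒᵖ] FirmPart j where
  toFun x := BalTensor.tmul _ _ r x
  map_add' x y := map_add _ x y
  map_smul' _ _ := rfl

theorem incl_add (j : R →ₙ+* ComodEnd A C X) (r s : R) : incl j (r + s) = incl j r + incl j s := by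
  ext x
  change BalTensor.tmul _ _ (r + s) x = BalTensor.tmul _ _ r x + BalTensor.tmul _ _ s x
  rw [map_add, AddMonoidHom.add_apply]

theorem incl_mul (j : R →ₙ+* ComodEnd A C X) (r s : R) :
    incl j (r * s) = incl j r ∘ₗ (j s : Module.End Aᵐᵒᵖ X) := by
  ext x
  exact BalTensor.tmul_balanced (α := fun r : R => AddMonoidHom.mulRight r) (β := endAct j) s r x

/-- The coaction `r ⊗ x ↦ (r ⊗ x₀) ⊗ x₁` on `R ⊗_R X`, as an additive map. -/
def coactHom (j : R →ₙ+* ComodEnd A C X) : FirmPart j →+ TensorOver A (FirmPart j) C :=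
  BalTensor.lift
    (AddMonoidHom.mk'
      (fun r => (TensorOver.rT C (incl j r)).comp (coact A C X).toAddMonoidHom)
      (fun r s => by
        ext x
        change TensorOver.rT C (incl j (r + s)) _ = _
        rw [incl_add, TensorOver.rT_add]
        rfl))
    (fun r s x => by
      change TensorOver.rT C (incl j (s * r)) (coact A C X x) =
        TensorOver.rT C (incl j s) (coact A C X ((j r : Module.End Aᵐᵒᵖ X) x))
      rw [(j r).2 x, incl_mul, TensorOver.rT_comp])

theorem coactHom_incl (j : R →ₙ+* ComodEnd A C X) (r : R) (x : X) :
    coactHom j (incl j r x) = TensorOver.rT C (incl j r) (coact A C X x) := rfl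

/-- The coaction `r ⊗ x ↦ (r ⊗ x₀) ⊗ x₁` on `R ⊗_R X`. -/
def coactLin (j : R →ₙ+* ComodEnd A C X) :
    FirmPart j →ₗ[Aᵐᵒᵖ] TensorOver A (FirmPart j) C where
  toFun := coactHom j
  map_add' := map_add _
  map_smul' a y := by
    induction y using BalTensor.induction with
    | tmul r x =>
      change coactHom j (incl j r (a • x)) = a • coactHom j (incl j r x)
      rw [coactHom_incl, coactHom_incl, map_smul, TensorOver.rT_op_smul]
    | add x y hx hy =>
      simp only [RingHom.id_apply] at hx hy ⊢
      rw [smul_add, map_add, hx, hy, map_add, smul_add]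

/-- The right `C`-comodule structure of `R ⊗_R X`. -/
instance (j : R →ₙ+* ComodEnd A C X) :
    RightComodule A C (BalTensor (fun r : R => AddMonoidHom.mulRight r) (endAct j)) where
  coact := coactLin j
  coassoc y := by
    induction y using BalTensor.induction with
    | tmul r x =>
      change TensorOver.assoc (TensorOver.rT C (coactLin j)
          (TensorOver.rT C (incl j r) (coact A C X x))) =
        TensorOver.lT _ (Coring.comul (A := A) (C := C)).left
          (TensorOver.rT C (incl j r) (coact A C X x))
      have h1 : coactLin j ∘ₗ incl j r =
          ({ toFun := TensorOver.rT C (incl j r)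
             map_add' := map_add _
             map_smul' := TensorOver.rT_op_smul _ } : TensorOver A X C →ₗ[Aᵐᵒᵖ] _) ∘ₗ
            coact A C X := rfl
      rw [← TensorOver.rT_comp, h1, TensorOver.rT_comp]
      have h2 : ∀ z : TensorOver A (TensorOver A X C) C,
          TensorOver.assoc (TensorOver.rT C ({ toFun := TensorOver.rT C (incl j r)
                                               map_add' := map_add _
                                               map_smul' := TensorOver.rT_op_smul _ } :
              TensorOver A X C →ₗ[Aᵐᵒᵖ] _) z) =
            TensorOver.rT (TensorOver A C C) (incl j r) (TensorOver.assoc z) := by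
        intro z
        induction z using BalTensor.induction with
        | tmul w c =>
          induction w using BalTensor.induction with
          | tmul x c' => rfl
          | add w w' h h' => simp only [map_add, AddMonoidHom.add_apply, h, h']
        | add w w' h h' => simp only [map_add, h, h']
      have h3 : ∀ z : TensorOver A X C,
          TensorOver.lT (FirmPart j) (Coring.comul (A := A) (C := C)).left
            (TensorOver.rT C (incl j r) z) =
          TensorOver.rT (TensorOver A C C) (incl j r)
            (TensorOver.lT X (Coring.comul (A := A) (C := C)).left z) := by
        intro z
        induction z using BalTensor.induction with
        | tmul x c => rfl
        | add w w' h h' => simp only [map_add, h, h']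
      rw [h2, h3, RightComodule.coassoc]
    | add x y hx hy => simp only [map_add, hx, hy]
  counit y := by
    induction y using BalTensor.induction with
    | tmul r x =>
      change TensorOver.rUnit (TensorOver.lT _ (Coring.counit (A := A) (C := C)).left
          (TensorOver.rT C (incl j r) (coact A C X x))) = incl j r x
      have h : ∀ z : TensorOver A X C,
          TensorOver.rUnit (TensorOver.lT (FirmPart j) (Coring.counit (A := A) (C := C)).left
            (TensorOver.rT C (incl j r) z)) =
          incl j r (TensorOver.rUnit (TensorOver.lT X (Coring.counit (A := A) (C := C)).left z)) := by
        intro z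
        induction z using BalTensor.induction with
        | tmul x c => rfl
        | add w w' h h' => simp only [map_add, h, h']
      rw [h, RightComodule.counit]
    | add x y hx hy => simp only [map_add, hx, hy]

/-- Left multiplication `s ⊗ x ↦ r s ⊗ x` on `R ⊗_R X`, as a right `A`-linear map. -/
def lmul (j : R →ₙ+* ComodEnd A C X) (r : R) : FirmPart j →ₗ[Aᵐᵒᵖ] FirmPart j where
  toFun := BalTensor.lift ((BalTensor.tmul _ _).comp (AddMonoidHom.mulLeft r))
    (fun t s x => by
      change BalTensor.tmul _ _ (r * (s * t)) x = BalTensor.tmul _ _ (r * s) (endAct j t x)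
      rw [← mul_assoc]
      exact BalTensor.tmul_balanced (α := fun r : R => AddMonoidHom.mulRight r) t (r * s) x)
  map_add' := map_add _
  map_smul' a y := by
    induction y using BalTensor.induction with
    | tmul s x => rfl
    | add x y hx hy =>
      simp only [RingHom.id_apply] at hx hy ⊢
      rw [smul_add, map_add, hx, hy, map_add, smul_add]

theorem lmul_incl (j : R →ₙ+* ComodEnd A C X) (r s : R) : lmul j r ∘ₗ incl j s = incl j (r * s) :=
  rfl

/-- The left `R`-module structure `r (s ⊗ x) = r s ⊗ x` on `R ⊗_R X`, which makes `R ⊗_R X` an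
`R`-`C`-bicomodule. -/
def toEnd (j : R →ₙ+* ComodEnd A C X) : R →ₙ+* ComodEnd A C (FirmPart j) where
  toFun r := ⟨lmul j r, fun y => by
    induction y using BalTensor.induction with
    | tmul s x =>
      change TensorOver.rT C (incl j (r * s)) (coact A C X x) =
        TensorOver.rT C (lmul j r) (TensorOver.rT C (incl j s) (coact A C X x))
      rw [← TensorOver.rT_comp, lmul_incl]
    | add x y hx hy => simp only [map_add, hx, hy]⟩
  map_mul' r s := by
    ext y
    change lmul j (r * s) y = lmul j r (lmul j s y)
    induction y using BalTensor.induction with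
    | tmul t x =>
      change BalTensor.tmul _ _ (r * s * t) x = BalTensor.tmul _ _ (r * (s * t)) x
      rw [mul_assoc]
    | add x y hx hy => simp only [map_add, hx, hy]
  map_zero' := by
    ext y
    change lmul j 0 y = 0
    induction y using BalTensor.induction with
    | tmul t x =>
      change BalTensor.tmul _ _ (0 * t) x = 0
      rw [zero_mul, map_zero, AddMonoidHom.zero_apply]
    | add x y hx hy => simp only [map_add, hx, hy, add_zero]
  map_add' r s := by
    ext y
    change lmul j (r + s) y = lmul j r y + lmul j s y
    induction y using BalTensor.induction with
    | tmul t x =>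
      change BalTensor.tmul _ _ ((r + s) * t) x =
        BalTensor.tmul _ _ (r * t) x + BalTensor.tmul _ _ (s * t) x
      rw [add_mul, map_add, AddMonoidHom.add_apply]
    | add x y hx hy => simp only [map_add, hx, hy]; abel

end FirmPart

/-! ### The canonical maps -/

/-- The right `R`-action `(f r)(x) = f (r x)` on `Hom_A(X, M)`. -/
def homAct (j : R →ₙ+* ComodEnd A C X) (M : Type*) [AddCommGroup M] [Module Aᵐᵒᵖ M] (r : R) :
    (X →ₗ[Aᵐᵒᵖ] M) →+ (X →ₗ[Aᵐᵒᵖ] M) :=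
  AddMonoidHom.mk' (fun f => f ∘ₗ (j r : Module.End Aᵐᵒᵖ X)) (fun f g => LinearMap.add_comp _ g f)

/-- The canonical map `can_M : Hom_A(X, M) ⊗_R X → M ⊗_A C`, `f ⊗ x ↦ f(x₀) ⊗ x₁`. -/
def canM (j : R →ₙ+* ComodEnd A C X) (M : Type*) [AddCommGroup M] [Module Aᵐᵒᵖ M] :
    BalTensor (homAct j M) (endAct j) →+ TensorOver A M C :=
  BalTensor.lift
    (AddMonoidHom.mk'
      (fun f : X →ₗ[Aᵐᵒᵖ] M => (TensorOver.rT C f).comp (coact A C X).toAddMonoidHom)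
      (fun f g => by ext x; exact TensorOver.rT_add f g _))
    (fun r f x => by
      change TensorOver.rT C (f ∘ₗ (j r : Module.End Aᵐᵒᵖ X)) (coact A C X x) =
        TensorOver.rT C f (coact A C X ((j r : Module.End Aᵐᵒᵖ X) x))
      rw [(j r).2 x, TensorOver.rT_comp])

/-- The canonical map `can : X* ⊗_R X → C`, `f ⊗ x ↦ f(x₀) x₁`, where `X* = Hom_A(X, A)`. -/
def can (j : R →ₙ+* ComodEnd A C X) : BalTensor (homAct j A) (endAct j) →+ C :=
  TensorOver.lUnit.comp (canM j A)

end Bicomodule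

/-! ### The elementary ring of a right module -/

section Elementary

variable (A X : Type*) [Ring A] [AddCommGroup X] [Module Aᵐᵒᵖ X]

/-- `Z = X ⊗_A X*`, where `X* = Hom_A(X, A)` has the left `A`-action `(a f)(x) = a f(x)`. -/
def ElementaryRing : Type _ := TensorOver A X (X →ₗ[Aᵐᵒᵖ] A)

namespace ElementaryRing

instance : AddCommGroup (ElementaryRing A X) :=
  inferInstanceAs (AddCommGroup (TensorOver A X (X →ₗ[Aᵐᵒᵖ] A)))

/-- The left action `(u ⊗ f) x = u f(x)` of `Z = X ⊗_A X*` on `X`. -/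
def act : ElementaryRing A X →+ Module.End Aᵐᵒᵖ X :=
  BalTensor.lift (α := rightAct A X) (β := leftAct A (X →ₗ[Aᵐᵒᵖ] A))
    (AddMonoidHom.mk' (fun u => AddMonoidHom.mk'
      (fun f : X →ₗ[Aᵐᵒᵖ] A =>
        ({ toFun := fun x => op (f x) • u
           map_add' := fun x y => by rw [map_add, MulOpposite.op_add, add_smul]
           map_smul' := fun a x => by
            rw [map_smul, RingHom.id_apply, ← mul_smul]
            rfl } : Module.End Aᵐᵒᵖ X))
      (fun f g => by
        ext x
        exact (congrArg (· • u) (MulOpposite.op_add (f x) (g x))).trans (add_smul _ _ u)))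
      (fun u v => by
        ext f x
        exact smul_add (op (f x)) u v))
    (fun a u f => by
      ext x
      change op (f x) • op a • u = op (a * f x) • u
      rw [MulOpposite.op_mul, mul_smul])

theorem act_rT (z w : ElementaryRing A X) :
    act A X (TensorOver.rT (X →ₗ[Aᵐᵒᵖ] A) (act A X z) w) = act A X z ∘ₗ act A X w := by
  let T : ElementaryRing A X →+ ElementaryRing A X :=
    TensorOver.rT (X →ₗ[Aᵐᵒᵖ] A) (act A X z)
  let L : Module.End Aᵐᵒᵖ X →+ Module.End Aᵐᵒᵖ X := AddMonoidHom.mulLeft (act A X z)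
  refine DFunLike.congr_fun (f := (act A X).comp T) (g := L.comp (act A X))
    (BalTensor.hom_ext fun v g => ?_) w
  ext x
  exact (map_smul (act A X z) (op (g x)) v).symm

/-- The multiplication `(u ⊗ f)(v ⊗ g) = u f(v) ⊗ g` of `Z = X ⊗_A X*`. -/
instance : NonUnitalRing (ElementaryRing A X) where
  mul z w := TensorOver.rT (X →ₗ[Aᵐᵒᵖ] A) (act A X z) w
  left_distrib z w w' := map_add (TensorOver.rT (X →ₗ[Aᵐᵒᵖ] A) (act A X z)) w w'
  right_distrib z z' w := by
    change TensorOver.rT (X →ₗ[Aᵐᵒᵖ] A) (act A X (z + z')) w = _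
    rw [map_add]
    exact TensorOver.rT_add _ _ w
  zero_mul w := by
    change TensorOver.rT (X →ₗ[Aᵐᵒᵖ] A) (act A X 0) w = 0
    rw [map_zero]
    have h := TensorOver.rT_add (0 : Module.End Aᵐᵒᵖ X) 0 w
    rwa [add_zero, left_eq_add] at h
  mul_zero z := map_zero (TensorOver.rT (X →ₗ[Aᵐᵒᵖ] A) (act A X z))
  mul_assoc z w x := by
    change TensorOver.rT (X →ₗ[Aᵐᵒᵖ] A)
      (act A X (TensorOver.rT (X →ₗ[Aᵐᵒᵖ] A) (act A X z) w)) x = _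
    rw [act_rT]
    exact TensorOver.rT_comp _ _ x

end ElementaryRing

end Elementary

/-! ### Galois comodules -/

section Galois

variable {A C X R : Type*} [Ring A] [AddCommGroup C] [Module A C] [Module Aᵐᵒᵖ C]
  [SMulCommClass A Aᵐᵒᵖ C] [Coring A C] [AddCommGroup X] [Module Aᵐᵒᵖ X] [RightComodule A C X]
  [NonUnitalRing R]

/-- `X` is `R`-firmly projective as a `C`-comodule: it is a firm left `R`-module, and its `R`-action
(by colinear maps) is induced by a ring morphism `ι : R → X ⊗_A X*`. -/
def IsFirmlyProjective (j : R →ₙ+* ComodEnd A C X) : Prop :=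
  IsFirmModule j ∧ ∃ ι : R →ₙ+* ElementaryRing A X,
    ∀ r : R, (j r : Module.End Aᵐᵒᵖ X) = ElementaryRing.act A X (ι r)

/-- `X` is an `R`-`C` Galois comodule: it is `R`-firmly projective as a `C`-comodule, and
`can : X* ⊗_R X → C` is an isomorphism. -/
def IsGaloisComodule (j : R →ₙ+* ComodEnd A C X) : Prop :=
  IsFirmlyProjective j ∧ Function.Bijective (can j)

/-- The `R`-`C`-bicomodule `X` is an `R`-`C` comonadic-Galois comodule: it is a firm left `R`-module
and `can_M : Hom_A(X, M) ⊗_R X → M ⊗_A C` is an isomorphism for every right `A`-module `M`. -/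
def IsComonadicGalois.{w, uA, uC, uX, uR} {A : Type uA} {C : Type uC} {X : Type uX} {R : Type uR}
    [Ring A] [AddCommGroup C] [Module A C] [Module Aᵐᵒᵖ C] [SMulCommClass A Aᵐᵒᵖ C] [Coring A C]
    [AddCommGroup X] [Module Aᵐᵒᵖ X] [RightComodule A C X] [NonUnitalRing R]
    (j : R →ₙ+* ComodEnd A C X) : Prop :=
  IsFirmModule j ∧
    ∀ (M : Type w) [AddCommGroup M] [Module Aᵐᵒᵖ M], Function.Bijective (canM j M)

end Galois

universe uA uC uX uR uS w

/-! Both halves of the argument exhibit `can_M` as the second factor of a bijection whose first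
factor is surjective.

For the `R`-module `Σ`, the rank-one maps give `M ⊗_A Σ* → Hom_A(Σ, M)`. After applying `- ⊗_R Σ`
and reassociating, `can_M` becomes `M ⊗_A can`, which is bijective. The first factor is surjective
because `Σ = RΣ`, and `R` acts on `Σ` through `Σ ⊗_A Σ*`.

To pass to `S ⊗_S Σ`, note that multiplication `p : S ⊗_S Σ → Σ` is colinear and has an `R`-linear
section `σ`, obtained from `Σ ≅ R ⊗_R Σ → S ⊗_S Σ`. Then `g ⊗ x ↦ g p ⊗ σ x` intertwines the two
canonical maps, and it is surjective because `f ⊗ (s ⊗ x) = f ⊗ s (σ x) = f(s ⊗ p -) ⊗ σ x`. -/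

namespace BalTensor

variable {R R' Q N N' M M' D P : Type*} [AddCommGroup N] [AddCommGroup N'] [AddCommGroup M]
  [AddCommGroup M'] [AddCommGroup D] [AddCommGroup P]

section Map

variable {α' : R' → N' →+ N'} {β' : R' → M' →+ M'} {α : R → N →+ N} {β : R → M →+ M}

/-- The map `f ⊗ g : N ⊗_R M → N' ⊗_{R'} M'`, for `f` and `g` equivariant along `φ : R → R'`. -/
def map (φ : R → R') (f : N →+ N') (g : M →+ M') (hf : ∀ r n, f (α r n) = α' (φ r) (f n))
    (hg : ∀ r m, g (β r m) = β' (φ r) (g m)) : BalTensor α β →+ BalTensor α' β' :=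
  lift (((tmul α' β').compl₂ g).comp f) fun r n m => by
    change tmul α' β' (f (α r n)) (g m) = tmul α' β' (f n) (g (β r m))
    rw [hf, hg, tmul_balanced]

theorem symm_act_of_rightInverse {φ : R → R'} {ψ : R' → R} (hψ : Function.RightInverse ψ φ)
    (e : N ≃+ N') (he : ∀ r n, e (α r n) = α' (φ r) (e n)) (r : R') (n : N') :
    e.symm (α' r n) = α (ψ r) (e.symm n) := by
  rw [AddEquiv.symm_apply_eq, he, hψ, e.apply_symm_apply]

theorem map_bijective {φ : R → R'} {f : N →+ N'} {g : M →+ M'}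
    {hf : ∀ r n, f (α r n) = α' (φ r) (f n)} {hg : ∀ r m, g (β r m) = β' (φ r) (g m)}
    (φ_surj : Function.Surjective φ) (f_bij : Function.Bijective f)
    (g_bij : Function.Bijective g) : Function.Bijective (map φ f g hf hg) := by
  obtain ⟨ψ, hψ⟩ := φ_surj.hasRightInverse
  let e := AddEquiv.ofBijective f f_bij
  let e' := AddEquiv.ofBijective g g_bij
  let inv : BalTensor α' β' →+ BalTensor α β :=
    map ψ e.symm e'.symm (symm_act_of_rightInverse hψ e hf) (symm_act_of_rightInverse hψ e' hg)
  have left_inv : inv.comp (map φ f g hf hg) = AddMonoidHom.id _ := hom_ext fun n m =>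
    congrArg₂ (tmul α β · ·) (e.symm_apply_apply n) (e'.symm_apply_apply m)
  have right_inv : (map φ f g hf hg).comp inv = AddMonoidHom.id _ := hom_ext fun n m =>
    congrArg₂ (tmul α' β' · ·) (e.apply_symm_apply n) (e'.apply_symm_apply m)
  exact (AddMonoidHom.toAddEquiv _ _ left_inv right_inv).bijective

theorem surjective_of_tmul_mem_range {F : P →+ BalTensor α β}
    (h : ∀ n m, tmul α β n m ∈ F.range) : Function.Surjective F := fun x => by
  induction x using induction with
  | tmul n m => exact h n m
  | add x y hx hy => exact F.range.add_mem hx hy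

end Map

section Assoc

variable {α : R → N →+ N} {β : R → M →+ M} {γ : Q → M →+ M} {δ : Q → D →+ D}

/-- The associativity isomorphism `(N ⊗_R M) ⊗_Q D ≃ N ⊗_R (M ⊗_Q D)` for an `R`-`Q`-bimodule
`M`. -/
def assoc (h : ∀ r q m, β r (γ q m) = γ q (β r m)) :
    BalTensor (fun q => mapRight (α := α) (γ q) fun r m => h r q m) δ ≃+
      BalTensor α (fun r => mapLeft (β := δ) (β r) fun q m => (h r q m).symm) :=
  AddMonoidHom.toAddEquiv
    (lift
      (lift ((AddMonoidHom.compHom.comp (tmul _ _)).compl₂ (tmul γ δ)) fun r n m => by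
        ext d
        exact tmul_balanced (α := α) r n (tmul γ δ m d))
      fun q x d => by
        induction x using induction with
        | tmul n m => exact congrArg (tmul _ _ n) (tmul_balanced q m d)
        | add x y hx hy => simp only [map_add, AddMonoidHom.add_apply, hx, hy])
    (lift
      (lift ((AddMonoidHom.compHom.comp (tmul _ _).flip).compl₂ (tmul α β).flip).flip
        fun q m d => by
          ext n
          exact tmul_balanced (β := δ) q (tmul α β n m) d).flip
      fun r n y => by
        induction y using induction with
        | tmul m d => exact congrArg (tmul _ _ · d) (tmul_balanced r n m)
        | add x y hx hy => simp only [map_add, hx, hy])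
    (hom_ext fun x d => by
      induction x using induction with
      | tmul n m => rfl
      | add x y hx hy => simp only [map_add, AddMonoidHom.add_apply, hx, hy])
    (hom_ext fun n y => by
      induction y using induction with
      | tmul m d => rfl
      | add x y hx hy => simp only [map_add, hx, hy])

end Assoc

end BalTensor

section RankOne

variable {A X : Type*} [Ring A] [AddCommGroup X] [Module Aᵐᵒᵖ X]
  {M' M : Type*} [AddCommGroup M'] [Module Aᵐᵒᵖ M'] [AddCommGroup M] [Module Aᵐᵒᵖ M]

/-- The rank-one map `x ↦ m g(x)` in `Hom_A(X, M)`, for `m ∈ M` and `g ∈ X* = Hom_A(X, A)`. -/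
def rankOne : M →+ (X →ₗ[Aᵐᵒᵖ] A) →+ X →ₗ[Aᵐᵒᵖ] M :=
  AddMonoidHom.mk' (fun m => AddMonoidHom.mk'
    (fun g =>
      { toFun := fun x => op (g x) • m
        map_add' := fun x y => by rw [map_add, MulOpposite.op_add, add_smul]
        map_smul' := fun a x => by
          rw [map_smul, RingHom.id_apply, ← mul_smul]
          rfl })
    fun g h => LinearMap.ext fun x => add_smul (op (g x)) (op (h x)) m)
    fun m n => by
      ext g x
      exact smul_add (op (g x)) m n

theorem comp_rankOne (f : M →ₗ[Aᵐᵒᵖ] M') (m : M) (g : X →ₗ[Aᵐᵒᵖ] A) :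
    f ∘ₗ rankOne m g = rankOne (f m) g :=
  LinearMap.ext fun x => map_smul f (op (g x)) m

variable (A X M) in
/-- The canonical map `M ⊗_A X* → Hom_A(X, M)`, `m ⊗ g ↦ m g(-)`. -/
def tensorDualHom : TensorOver A M (X →ₗ[Aᵐᵒᵖ] A) →+ X →ₗ[Aᵐᵒᵖ] M :=
  BalTensor.lift rankOne fun a m g => LinearMap.ext fun x => (mul_smul (op (g x)) (op a) m).symm

theorem tensorDualHom_rT (f : M →ₗ[Aᵐᵒᵖ] M') (w : TensorOver A M (X →ₗ[Aᵐᵒᵖ] A)) :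
    tensorDualHom A X M' (TensorOver.rT _ f w) = f ∘ₗ tensorDualHom A X M w := by
  induction w using BalTensor.induction with
  | tmul m g => exact (comp_rankOne f m g).symm
  | add v w hv hw => rw [map_add, map_add, map_add, hv, hw, LinearMap.comp_add]

theorem comp_act_mem_range_tensorDualHom (f : X →ₗ[Aᵐᵒᵖ] M) (w : ElementaryRing A X) :
    f ∘ₗ ElementaryRing.act A X w ∈ (tensorDualHom A X M).range :=
  ⟨TensorOver.rT _ f w, tensorDualHom_rT f w⟩

theorem rT_rankOne {C : Type*} [AddCommGroup C] [Module A C] (m : M) (g : X →ₗ[Aᵐᵒᵖ] A)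
    (w : TensorOver A X C) :
    TensorOver.rT C (rankOne m g) w =
      TensorOver.mk A m (TensorOver.lUnit (TensorOver.rT C g w)) := by
  induction w using BalTensor.induction with
  | tmul x c => exact BalTensor.tmul_balanced (α := rightAct A M) (β := leftAct A C) (g x) m c
  | add v w hv hw => simp only [map_add, hv, hw]

theorem lUnit_rT_smul {C : Type*} [AddCommGroup C] [Module A C] (a : A) (g : X →ₗ[Aᵐᵒᵖ] A)
    (w : TensorOver A X C) :
    TensorOver.lUnit (TensorOver.rT C (a • g) w) = a • TensorOver.lUnit (TensorOver.rT C g w) := by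
  induction w using BalTensor.induction with
  | tmul x c => exact mul_smul a (g x) c
  | add v w hv hw => simp only [map_add, smul_add, hv, hw]

end RankOne

section Galois

variable {A C X R : Type*} [Ring A] [AddCommGroup C] [Module A C] [Module Aᵐᵒᵖ C]
  [SMulCommClass A Aᵐᵒᵖ C] [Coring A C] [AddCommGroup X] [Module Aᵐᵒᵖ X] [RightComodule A C X]
  [NonUnitalRing R] (j : R →ₙ+* ComodEnd A C X) (M : Type*) [AddCommGroup M] [Module Aᵐᵒᵖ M]

/-- The left `A`-action `a (g ⊗ x) = a g ⊗ x` on `X* ⊗_R X`. -/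
abbrev dualTensorAct (a : A) :
    BalTensor (homAct j A) (endAct j) →+ BalTensor (homAct j A) (endAct j) :=
  BalTensor.mapLeft (leftAct A (X →ₗ[Aᵐᵒᵖ] A) a) fun _ _ => rfl

theorem can_dualTensorAct (a : A) (z : BalTensor (homAct j A) (endAct j)) :
    can j (dualTensorAct j a z) = a • can j z := by
  induction z using BalTensor.induction with
  | tmul g x => exact lUnit_rT_smul a g (coact A C X x)
  | add y z hy hz => simp only [map_add, smul_add, hy, hz]

/-- The map `M ⊗_A can : M ⊗_A (X* ⊗_R X) → M ⊗_A C`. -/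
def tensorCan : BalTensor (rightAct A M) (dualTensorAct j) →+ TensorOver A M C :=
  BalTensor.map id (AddMonoidHom.id M) (can j) (fun _ _ => rfl) (can_dualTensorAct j)

/-- The right `R`-action `(m ⊗ g) r = m ⊗ g r` on `M ⊗_A X*`. -/
abbrev tensorDualAct (r : R) :
    TensorOver A M (X →ₗ[Aᵐᵒᵖ] A) →+ TensorOver A M (X →ₗ[Aᵐᵒᵖ] A) :=
  BalTensor.mapRight (homAct j A r) fun _ _ => rfl

theorem tensorDualHom_tensorDualAct (r : R) (w : TensorOver A M (X →ₗ[Aᵐᵒᵖ] A)) :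
    tensorDualHom A X M (tensorDualAct j M r w) = homAct j M r (tensorDualHom A X M w) := by
  induction w using BalTensor.induction with
  | tmul m g => rfl
  | add v w hv hw => simp only [map_add, hv, hw]

/-- The map `(M ⊗_A X*) ⊗_R X → Hom_A(X, M) ⊗_R X`, `(m ⊗ g) ⊗ x ↦ m g(-) ⊗ x`. -/
def rankOneTensor :
    BalTensor (tensorDualAct j M) (endAct j) →+ BalTensor (homAct j M) (endAct j) :=
  BalTensor.map id (tensorDualHom A X M) (AddMonoidHom.id X) (tensorDualHom_tensorDualAct j M)
    fun _ _ => rfl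

theorem canM_comp_rankOneTensor :
    canM j M ∘ rankOneTensor j M =
      tensorCan j M ∘ BalTensor.assoc (β := leftAct A (X →ₗ[Aᵐᵒᵖ] A)) fun _ _ _ => rfl := by
  funext z
  simp only [Function.comp_apply]
  induction z using BalTensor.induction with
  | tmul w x =>
    induction w using BalTensor.induction with
    | tmul m g => exact rT_rankOne m g (coact A C X x)
    | add v w hv hw => simp only [map_add, AddMonoidHom.add_apply, hv, hw]
  | add y z hy hz => simp only [map_add, hy, hz]

variable {j}

theorem actMap_induction (hj : Function.Surjective (actMap j)) {p : X → Prop} (x : X)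
    (smul : ∀ r x, p ((j r : Module.End Aᵐᵒᵖ X) x)) (add : ∀ x y, p x → p y → p (x + y)) :
    p x := by
  obtain ⟨z, rfl⟩ := hj x
  induction z using BalTensor.induction with
  | tmul r x => exact smul r x
  | add y z hy hz => rw [map_add]; exact add _ _ hy hz

theorem rankOneTensor_surjective (hj : Function.Surjective (actMap j))
    (hact : ∀ r, (j r : Module.End Aᵐᵒᵖ X) ∈ (ElementaryRing.act A X).range) :
    Function.Surjective (rankOneTensor j M) := by
  refine BalTensor.surjective_of_tmul_mem_range fun f x => ?_
  induction x using actMap_induction hj with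
  | smul r x =>
    obtain ⟨w, hw⟩ := hact r
    obtain ⟨z, hz⟩ := comp_act_mem_range_tensorDualHom f w
    refine ⟨BalTensor.tmul _ _ z x, ?_⟩
    calc BalTensor.tmul _ _ (tensorDualHom A X M z) x
        = BalTensor.tmul _ _ (homAct j M r f) x := by rw [hz, hw]; rfl
      _ = BalTensor.tmul _ _ f (endAct j r x) := BalTensor.tmul_balanced r f x
  | add x y hx hy => rw [map_add]; exact AddSubgroup.add_mem _ hx hy

theorem canM_bijective_of_can_bijective (hj : Function.Surjective (actMap j))
    (hact : ∀ r, (j r : Module.End Aᵐᵒᵖ X) ∈ (ElementaryRing.act A X).range)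
    (hcan : Function.Bijective (can j)) : Function.Bijective (canM j M) := by
  have tensorCan_bijective : Function.Bijective (tensorCan j M) :=
    BalTensor.map_bijective Function.surjective_id Function.bijective_id hcan
  have comp_bijective : Function.Bijective (canM j M ∘ rankOneTensor j M) := by
    rw [canM_comp_rankOneTensor]
    exact tensorCan_bijective.comp (BalTensor.assoc _).bijective
  exact ⟨comp_bijective.injective.of_comp_right (rankOneTensor_surjective M hj hact),
    comp_bijective.surjective.of_comp⟩

end Galois

section ChangeOfBicomodule

variable {A C X Y R S : Type*} [Ring A] [AddCommGroup C] [Module A C] [Module Aᵐᵒᵖ C]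
  [SMulCommClass A Aᵐᵒᵖ C] [Coring A C] [AddCommGroup X] [Module Aᵐᵒᵖ X] [RightComodule A C X]
  [AddCommGroup Y] [Module Aᵐᵒᵖ Y] [RightComodule A C Y] [NonUnitalRing R] [NonUnitalRing S]
  {jX : R →ₙ+* ComodEnd A C X} {jY : S →ₙ+* ComodEnd A C Y}
  (M : Type*) [AddCommGroup M] [Module Aᵐᵒᵖ M]

/-- The map `Hom_A(X, M) ⊗_R X → Hom_A(Y, M) ⊗_S Y`, `g ⊗ x ↦ g p ⊗ σ x`, for `p : Y → X` and
`σ : X → Y` equivariant along `i : R → S`. -/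
def homTensorMap (i : R →ₙ+* S) (p : Y →ₗ[Aᵐᵒᵖ] X) (σ : X →+ Y)
    (hp : ∀ r, (jX r : Module.End Aᵐᵒᵖ X) ∘ₗ p = p ∘ₗ (jY (i r) : Module.End Aᵐᵒᵖ Y))
    (hσ : ∀ r x, σ (endAct jX r x) = endAct jY (i r) (σ x)) :
    BalTensor (homAct jX M) (endAct jX) →+ BalTensor (homAct jY M) (endAct jY) :=
  BalTensor.map i (LinearMap.lcomp ℤ M p).toAddMonoidHom σ
    (fun r g => congrArg (g ∘ₗ ·) (hp r)) hσ

theorem canM_comp_homTensorMap {i : R →ₙ+* S} {p : Y →ₗ[Aᵐᵒᵖ] X} {σ : X →+ Y}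
    (hp : ∀ r, (jX r : Module.End Aᵐᵒᵖ X) ∘ₗ p = p ∘ₗ (jY (i r) : Module.End Aᵐᵒᵖ Y))
    (hσ : ∀ r x, σ (endAct jX r x) = endAct jY (i r) (σ x))
    (p_colinear : ∀ y, coact A C X (p y) = TensorOver.rT C p (coact A C Y y))
    (p_σ : ∀ x, p (σ x) = x) :
    canM jY M ∘ homTensorMap M i p σ hp hσ = canM jX M := by
  have comp_eq : (canM jY M).comp (homTensorMap M i p σ hp hσ) = canM jX M :=
    BalTensor.hom_ext fun g x =>
      calc TensorOver.rT C (g ∘ₗ p) (coact A C Y (σ x))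
          = TensorOver.rT C g (coact A C X (p (σ x))) := by rw [TensorOver.rT_comp, p_colinear]
        _ = TensorOver.rT C g (coact A C X x) := by rw [p_σ]
  rw [← comp_eq, AddMonoidHom.coe_comp]

end ChangeOfBicomodule

section FirmPart

variable {A C X R S : Type*} [Ring A] [AddCommGroup C] [Module A C] [Module Aᵐᵒᵖ C]
  [SMulCommClass A Aᵐᵒᵖ C] [Coring A C] [AddCommGroup X] [Module Aᵐᵒᵖ X] [RightComodule A C X]
  [NonUnitalRing R] [NonUnitalRing S]

theorem ringMulMap_mapRight (s : S)
    (z : BalTensor (fun s : S => AddMonoidHom.mulRight s) fun s => AddMonoidHom.mulLeft s) :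
    ringMulMap S (BalTensor.mapRight (AddMonoidHom.mulRight s)
      (fun r t => (mul_assoc r t s).symm) z) = ringMulMap S z * s := by
  induction z using BalTensor.induction with
  | tmul r t => exact (mul_assoc r t s).symm
  | add y z hy hz => simp only [map_add, add_mul, hy, hz]

namespace FirmPart

variable (j : S →ₙ+* ComodEnd A C X)

/-- The tensor product `(S ⊗_S S) ⊗_S X`. -/
abbrev SquareTensor : Type _ :=
  BalTensor (fun s : S => BalTensor.mapRight (α := fun r : S => AddMonoidHom.mulRight r)
    (β := fun r : S => AddMonoidHom.mulLeft r) (AddMonoidHom.mulRight s)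
    fun r t => (mul_assoc r t s).symm) (endAct j)

/-- The associativity isomorphism `(S ⊗_S S) ⊗_S X ≃ S ⊗_S (S ⊗_S X)`. -/
def assoc : SquareTensor j ≃+ FirmPart (toEnd j) :=
  BalTensor.assoc fun r s t => (mul_assoc r t s).symm

/-- The map `(S ⊗_S S) ⊗_S X → S ⊗_S X`, `(s ⊗ t) ⊗ x ↦ s t ⊗ x`. -/
def mulTensor : SquareTensor j →+ FirmPart j :=
  BalTensor.map id (ringMulMap S) (AddMonoidHom.id X) ringMulMap_mapRight fun _ _ => rfl

theorem actMap_toEnd_comp_assoc : actMap (toEnd j) ∘ assoc j = mulTensor j := by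
  funext z
  simp only [Function.comp_apply]
  induction z using BalTensor.induction with
  | tmul w x =>
    induction w using BalTensor.induction with
    | tmul s t => rfl
    | add v w hv hw => simp only [map_add, AddMonoidHom.add_apply, hv, hw]
  | add y z hy hz => simp only [map_add, hy, hz]

theorem isFirmModule_toEnd (hS : IsFirmRing S) : IsFirmModule (toEnd j) := by
  have mulTensor_bijective : Function.Bijective (mulTensor j) :=
    BalTensor.map_bijective Function.surjective_id hS Function.bijective_id
  rw [← actMap_toEnd_comp_assoc] at mulTensor_bijective
  exact (Function.Bijective.of_comp_iff _ (assoc j).bijective).1 mulTensor_bijective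

/-- The multiplication map `S ⊗_S X → X` as a right `A`-linear map. -/
def actLin : FirmPart j →ₗ[Aᵐᵒᵖ] X where
  toFun := actMap j
  map_add' := map_add _
  map_smul' a y := by
    induction y using BalTensor.induction with
    | tmul s x => exact map_smul (j s : Module.End Aᵐᵒᵖ X) a x
    | add x y hx hy => simp_all only [RingHom.id_apply, smul_add, map_add]

theorem actLin_comp_incl (s : S) : actLin j ∘ₗ incl j s = (j s : Module.End Aᵐᵒᵖ X) := rfl

theorem lmul_eq_incl_comp_actLin (s : S) : lmul j s = incl j s ∘ₗ actLin j := by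
  ext y
  induction y using BalTensor.induction with
  | tmul t x => exact LinearMap.congr_fun (incl_mul j s t) x
  | add x y hx hy => rw [map_add, map_add, hx, hy]

theorem comp_actLin (s : S) :
    (j s : Module.End Aᵐᵒᵖ X) ∘ₗ actLin j = actLin j ∘ₗ lmul j s := by
  rw [lmul_eq_incl_comp_actLin, ← LinearMap.comp_assoc, actLin_comp_incl]

theorem coact_actLin (y : FirmPart j) :
    coact A C X (actLin j y) = TensorOver.rT C (actLin j) (coact A C (FirmPart j) y) := by
  induction y using BalTensor.induction with
  | tmul s x =>
    calc coact A C X ((j s : Module.End Aᵐᵒᵖ X) x)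
        = TensorOver.rT C (actLin j ∘ₗ incl j s) (coact A C X x) := (j s).2 x
      _ = TensorOver.rT C (actLin j) (TensorOver.rT C (incl j s) (coact A C X x)) :=
        TensorOver.rT_comp _ _ _
  | add x y hx hy => simp only [map_add, hx, hy]

variable {j} (i : R →ₙ+* S)

variable (j) in
/-- The map `R ⊗_R X → S ⊗_S X`, `r ⊗ x ↦ i r ⊗ x`. -/
def changeRing : FirmPart (j.comp i) →+ FirmPart j :=
  BalTensor.map i (i : R →+ S) (AddMonoidHom.id X) (fun r s => map_mul i s r) fun _ _ => rfl

theorem actMap_changeRing (z : FirmPart (j.comp i)) :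
    actMap j (changeRing j i z) = actMap (j.comp i) z :=
  DFunLike.congr_fun (f := (actMap j).comp (changeRing j i)) (g := actMap (j.comp i))
    (BalTensor.hom_ext fun _ _ => rfl) z

variable {i} (hj : IsFirmModule (j.comp i))

/-- The section `X ≃ R ⊗_R X → S ⊗_S X` of the multiplication map `S ⊗_S X → X`, for `X` firm
over `R`. -/
noncomputable def sectionOfFirm : X →+ FirmPart j :=
  (changeRing j i).comp (AddEquiv.ofBijective (actMap (j.comp i)) hj).symm.toAddMonoidHom

theorem actLin_sectionOfFirm (x : X) : actLin j (sectionOfFirm hj x) = x :=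
  (actMap_changeRing i _).trans ((AddEquiv.ofBijective (actMap (j.comp i)) hj).apply_symm_apply x)

theorem lmul_sectionOfFirm (s : S) (x : X) : lmul j s (sectionOfFirm hj x) = incl j s x := by
  rw [lmul_eq_incl_comp_actLin, LinearMap.comp_apply, actLin_sectionOfFirm]

theorem sectionOfFirm_smul (r : R) (x : X) :
    sectionOfFirm hj (endAct (j.comp i) r x) = lmul j (i r) (sectionOfFirm hj x) := by
  rw [lmul_sectionOfFirm]
  exact congrArg (changeRing j i)
    ((AddEquiv.ofBijective (actMap (j.comp i)) hj).symm_apply_apply (BalTensor.tmul _ _ r x))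

variable (M : Type*) [AddCommGroup M] [Module Aᵐᵒᵖ M]

/-- The map `Hom_A(X, M) ⊗_R X → Hom_A(S ⊗_S X, M) ⊗_S (S ⊗_S X)` given by the multiplication
map `S ⊗_S X → X` and its section. -/
noncomputable def homTensorToFirmPart :
    BalTensor (homAct (j.comp i) M) (endAct (j.comp i)) →+
      BalTensor (homAct (toEnd j) M) (endAct (toEnd j)) :=
  homTensorMap M i (actLin j) (sectionOfFirm hj) (fun r => comp_actLin j (i r))
    (sectionOfFirm_smul hj)

theorem canM_comp_homTensorToFirmPart :
    canM (toEnd j) M ∘ homTensorToFirmPart hj M = canM (j.comp i) M :=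
  canM_comp_homTensorMap M _ _ (coact_actLin j) (actLin_sectionOfFirm hj)

theorem homTensorToFirmPart_surjective : Function.Surjective (homTensorToFirmPart hj M) := by
  refine BalTensor.surjective_of_tmul_mem_range fun f y => ?_
  induction y using BalTensor.induction with
  | tmul s x =>
    refine ⟨BalTensor.tmul _ _ (f ∘ₗ incl j s) x, ?_⟩
    calc BalTensor.tmul _ (endAct (toEnd j)) (f ∘ₗ incl j s ∘ₗ actLin j) (sectionOfFirm hj x)
        = BalTensor.tmul (homAct (toEnd j) M) _ (f ∘ₗ lmul j s) (sectionOfFirm hj x) := by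
          rw [lmul_eq_incl_comp_actLin]
      _ = BalTensor.tmul _ _ f (lmul j s (sectionOfFirm hj x)) :=
          BalTensor.tmul_balanced s f (sectionOfFirm hj x)
      _ = BalTensor.tmul _ _ f (incl j s x) := by rw [lmul_sectionOfFirm]
  | add x y hx hy => rw [map_add]; exact AddSubgroup.add_mem _ hx hy

include hj in
theorem canM_toEnd_bijective (hcan : Function.Bijective (canM (j.comp i) M)) :
    Function.Bijective (canM (toEnd j) M) := by
  have comp_bijective : Function.Bijective (canM (toEnd j) M ∘ homTensorToFirmPart hj M) := by
    rwa [canM_comp_homTensorToFirmPart]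
  exact ⟨comp_bijective.injective.of_comp_right (homTensorToFirmPart_surjective hj M),
    comp_bijective.surjective.of_comp⟩

end FirmPart

end FirmPart

theorem proposition4p1_general {A : Type uA} {C : Type uC} {X : Type uX}
    {R : Type uR} {S : Type uS} [Ring A] [AddCommGroup C] [Module A C] [Module Aᵐᵒᵖ C]
    [SMulCommClass A Aᵐᵒᵖ C] [Coring A C] [AddCommGroup X] [Module Aᵐᵒᵖ X] [RightComodule A C X]
    [NonUnitalRing R] [NonUnitalRing S] (hS : IsFirmRing S) (i : R →ₙ+* S)
    (j : S →ₙ+* ComodEnd A C X) (hfirm : IsFirmModule (j.comp i))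
    (hact : ∀ r, (j (i r) : Module.End Aᵐᵒᵖ X) ∈ (ElementaryRing.act A X).range)
    (hcan : Function.Bijective (can (j.comp i))) :
    IsComonadicGalois.{w} (FirmPart.toEnd j) :=
  ⟨FirmPart.isFirmModule_toEnd j hS, fun M _ _ => FirmPart.canM_toEnd_bijective hfirm M <|
    canM_bijective_of_can_bijective M hfirm.surjective hact hcan⟩

theorem proposition4p1 {A : Type uA} {C : Type uC} {X : Type uX}
    {R : Type uR} {S : Type uS} [Ring A] [AddCommGroup C] [Module A C] [Module Aᵐᵒᵖ C]
    [SMulCommClass A Aᵐᵒᵖ C] [Coring A C] [AddCommGroup X] [Module Aᵐᵒᵖ X] [RightComodule A C X]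
    [NonUnitalRing R] (hR : IsFirmRing R) (jR : R →ₙ+* ComodEnd A C X)
    (hX : IsGaloisComodule jR)
    [NonUnitalRing S] (hS : IsFirmRing S) (i : R →ₙ+* S) (jS : S →ₙ+* ComodEnd A C X)
    (hij : jS.comp i = jR) :
    IsComonadicGalois.{w} (FirmPart.toEnd jS) := by
  subst hij
  obtain ⟨⟨hfirm, ι, hι⟩, hcan⟩ := hX
  exact proposition4p1_general hS i jS hfirm (fun r => ⟨ι r, (hι r).symm⟩) hcan
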